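/- Let $d\in\mathbb{N}$, $L>0$, and equip $\mathbb{R}^d$ with the Euclidean norm and inner product. A function $f$ that is differentiable at the points of a convex set $S\subseteq\mathbb{R}^d$, with gradient $f'$, is called \emph{$L$-smooth over $S$} if $\|f'(u)-f'(v)\|\le L\|u-v\|$ for all $u,v\in S$, and \emph{convex over $S$} if $0\le f(v)-f(u)-\langle f'(u),v-u\rangle$ for all $u,v\in S$. For an integer $N>0$, $x,y,g_x,g_y\in\mathbb{R}^d$ and $f_x\in\mathbb{R}$, let $$ \begin{aligned} U_N(x,f_x,g_x,y,g_y):=\max_{g_0,\dots,g_N\in\mathbb{R}^d,\ f_0,\dots,f_N\in\mathbb{R}}\ & f_N\\ \text{s.t. } & \tfrac{1}{2L}\|g_i-g_{i+1}\|^2\le f_i-f_{i+1}-\tfrac1N\langle g_{i+1},x-y\rangle, && 0\le i<N,\\ & \tfrac{1}{2L}\|g_i-g_{i+1}\|^2\le f_{i+1}-f_i-\tfrac1N\langle g_i,y-x\rangle, && 0\le i<N,\\ & f_0=f_x,\quad g_0=g_x,\quad g_N=g_y, \end{aligned} $$ and let $B_N(x,f_x,g_x,y,g_y)$ be the minimum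 of $f_N$ under the same constraints. The maximum and the minimum are attained whenever the constraints are feasible; if they are infeasible, put $U_N=-\infty$ and $B_N=+\infty$. Then: 1. Let $C\subsetneq\mathbb{R}^d$ be an open convex set, let $f:C\to\mathbb{R}$ be differentiable, $L$-smooth and convex over $C$, and let $x,y\in C$. Then $$B_N(x,f(x),f'(x),y,f'(y))\le f(y)\le U_N(x,f(x),f'(x),y,f'(y))$$ for every integer $N$ with $$N>\frac{\|y-x\|}{\min\big(\mathrm{dist}(x,\mathbb{R}^d\setminus C),\,\mathrm{dist}(y,\mathbb{R}^d\setminus C)\big)}.$$ 2. Conversely, let $x,y\in\mathbb{R}^d$, $f_x,f_y\in\mathbb{R}$, $g_x,g_y\in\mathbb{R}^d$ and an integer $N>0$ be given such that $$B_N(x,f_x,g_x,y,g_y)\le f_y\le U_N(x,f_x,g_x,y,g_y).$$ Then there exists a differentiable function $F:\mathbb{R}^d\to\mathbb{R}$ that is $L$-smooth and convex over the segment $[x,y]$ and satisfies $F(x)=f_x$, $F(y)=f_y$, $F'(x)=g_x$, $F'(y)=g_y$. -/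

import Mathlib

namespace SmoothConvex

/-- `f` (a function differentiable at the points of `S`) is convex over `S`, expressed by the
first-order inequality `0 ≤ f v - f u - ⟨f' u, v - u⟩`. -/
def ConvexOver {d : ℕ} (f : EuclideanSpace ℝ (Fin d) → ℝ)
    (S : Set (EuclideanSpace ℝ (Fin d))) : Prop :=
  ∀ u ∈ S, ∀ v ∈ S, 0 ≤ f v - f u - inner ℝ (gradient f u) (v - u)

/-- `f` (a function differentiable at the points of `S`) is `L`-smooth over `S`: its gradient is
`L`-Lipschitz on `S`. -/
def SmoothOver {d : ℕ} (L : ℝ) (f : EuclideanSpace ℝ (Fin d) → ℝ)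
    (S : Set (EuclideanSpace ℝ (Fin d))) : Prop :=
  ∀ u ∈ S, ∀ v ∈ S, ‖gradient f u - gradient f v‖ ≤ L * ‖u - v‖

/-- Feasibility of the values `f₀, …, f_N` and gradients `g₀, …, g_N` for the quadratically
constrained program with data `x, f_x, g_x, y, g_y`. -/
structure Feasible {d : ℕ} (L : ℝ) (N : ℕ) (x : EuclideanSpace ℝ (Fin d)) (fx : ℝ)
    (gx y gy : EuclideanSpace ℝ (Fin d))
    (f : Fin (N + 1) → ℝ) (g : Fin (N + 1) → EuclideanSpace ℝ (Fin d)) : Prop where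
  backward : ∀ i : Fin N, 1 / (2 * L) * ‖g i.castSucc - g i.succ‖ ^ 2 ≤
    f i.castSucc - f i.succ - 1 / (N : ℝ) * inner ℝ (g i.succ) (x - y)
  forward : ∀ i : Fin N, 1 / (2 * L) * ‖g i.castSucc - g i.succ‖ ^ 2 ≤
    f i.succ - f i.castSucc - 1 / (N : ℝ) * inner ℝ (g i.castSucc) (y - x)
  value_start : f 0 = fx
  grad_start : g 0 = gx
  grad_end : g (Fin.last N) = gy

/-- The set of objective values `f_N` over all feasible points of the program. -/
def feasibleValues {d : ℕ} (L : ℝ) (N : ℕ) (x : EuclideanSpace ℝ (Fin d)) (fx : ℝ)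
    (gx y gy : EuclideanSpace ℝ (Fin d)) : Set ℝ :=
  {v | ∃ (f : Fin (N + 1) → ℝ) (g : Fin (N + 1) → EuclideanSpace ℝ (Fin d)),
    Feasible L N x fx gx y gy f g ∧ f (Fin.last N) = v}

/-- The optimal value `U_N` of the maximization program, as an extended real
(`-∞` when the program is infeasible). -/
noncomputable def upperValue {d : ℕ} (L : ℝ) (N : ℕ) (x : EuclideanSpace ℝ (Fin d)) (fx : ℝ)
    (gx y gy : EuclideanSpace ℝ (Fin d)) : EReal :=
  ⨆ v ∈ feasibleValues L N x fx gx y gy, (v : EReal)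

/-- The optimal value `B_N` of the minimization program, as an extended real
(`+∞` when the program is infeasible). -/
noncomputable def lowerValue {d : ℕ} (L : ℝ) (N : ℕ) (x : EuclideanSpace ℝ (Fin d)) (fx : ℝ)
    (gx y gy : EuclideanSpace ℝ (Fin d)) : EReal :=
  ⨅ v ∈ feasibleValues L N x fx gx y gy, (v : EReal)

end SmoothConvex

/-! Both parts reduce to one statement: the numbers between the two optimal values are exactly the
objective values of feasible points. Consecutive constraints bound the increments of gradients and
values, so the feasible set is compact; each constraint is a convex quadratic below an affine
function, so it is convex. Hence the attained values form a compact interval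
(`mem_feasibleValues_of_between`).

For part 1, sample `f` and its gradient at equally spaced points of the segment. The proof of the
interpolation inequality only evaluates `f` along one gradient step, whose length is at most the
spacing; the bound on `N` keeps that step inside `C` (`interpolation_inequality`).

For part 2, feasible data are first joined by a gradient path along the line. Between two nodes the
gradient moves straight from one value to the next, as fast as the Lipschitz bound allows, and the
two constraints say exactly that the move can be timed to give the required increment of the value
(`exists_profile`, `exists_gradient_path`). The path `G` must then be the gradient of a function on
the whole space. Adding the pairing of `G` with the orthogonal component would give the right
gradient on the line, but `G` need not be differentiable; replacing `G` by a difference quotient of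
its primitive `Ψ`, with increment the squared distance to the line, restores differentiability off
the line (`lineExtension`). -/

namespace SmoothConvex

/-! ### The feasible set is compact and convex -/

section Program

variable {d : ℕ} {L : ℝ} {N : ℕ} {x : EuclideanSpace ℝ (Fin d)} {fx : ℝ}
  {gx y gy : EuclideanSpace ℝ (Fin d)}

/-- Consecutive gradients of a feasible point are at bounded distance. -/
theorem Feasible.norm_grad_sub_le (hL : 0 < L) {f : Fin (N + 1) → ℝ}
    {g : Fin (N + 1) → EuclideanSpace ℝ (Fin d)} (h : Feasible L N x fx gx y gy f g) (i : Fin N) :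
    ‖g i.castSucc - g i.succ‖ ≤ L * (1 / (N : ℝ) * ‖y - x‖) := by
  have h1 := h.backward i
  have h2 := h.forward i
  have h3 : inner ℝ (g i.succ - g i.castSucc) (y - x)
      ≤ ‖g i.castSucc - g i.succ‖ * ‖y - x‖ := by
    rw [norm_sub_rev]
    exact real_inner_le_norm _ _
  have h4 : inner ℝ (g i.succ) (x - y) = - inner ℝ (g i.succ) (y - x) := by
    rw [← inner_neg_right, neg_sub]
  rw [inner_sub_left] at h3
  rw [h4] at h1
  set D := ‖g i.castSucc - g i.succ‖
  -- Adding the two constraints cancels the function values and leaves cocoercivity of the gradient.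
  have h5 : 1 / L * D ^ 2 ≤ 1 / (N : ℝ) * (D * ‖y - x‖) := by
    have := mul_le_mul_of_nonneg_left h3 (by positivity : 0 ≤ 1 / (N : ℝ))
    have e : 1 / L * D ^ 2 = 1 / (2 * L) * D ^ 2 + 1 / (2 * L) * D ^ 2 := by
      field_simp; norm_num
    linarith
  have hD : 0 ≤ D := norm_nonneg _
  rcases hD.eq_or_lt with h0 | h0
  · rw [← h0]; positivity
  · have e1 : D * (1 / L * D) ≤ D * (1 / (N : ℝ) * ‖y - x‖) := by
      calc D * (1 / L * D) = 1 / L * D ^ 2 := by ring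
        _ ≤ _ := h5
        _ = _ := by ring
    have e2 := mul_le_mul_of_nonneg_left (le_of_mul_le_mul_left e1 h0) hL.le
    calc D = L * (1 / L * D) := by field_simp
      _ ≤ _ := e2

theorem Feasible.norm_grad_le (hL : 0 < L) {f : Fin (N + 1) → ℝ}
    {g : Fin (N + 1) → EuclideanSpace ℝ (Fin d)} (h : Feasible L N x fx gx y gy f g)
    (i : Fin (N + 1)) : ‖g i‖ ≤ ‖gx‖ + i * (L * (1 / (N : ℝ) * ‖y - x‖)) := by
  induction i using Fin.induction with
  | zero => simp [h.grad_start]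
  | succ i ih =>
    have h1 := h.norm_grad_sub_le hL i
    have h2 : ‖g i.succ‖ ≤ ‖g i.castSucc‖ + ‖g i.castSucc - g i.succ‖ := by
      have := norm_sub_le (g i.castSucc) (g i.castSucc - g i.succ)
      simpa using this
    simp only [Fin.val_castSucc] at ih
    simp only [Fin.val_succ, Nat.cast_add, Nat.cast_one]
    linarith

/-- The two constraints bound each value increment from opposite sides by inner products with
gradients, which are already bounded. -/
theorem Feasible.abs_value_le (hL : 0 < L) {f : Fin (N + 1) → ℝ}
    {g : Fin (N + 1) → EuclideanSpace ℝ (Fin d)} (h : Feasible L N x fx gx y gy f g)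
    (i : Fin (N + 1)) : |f i| ≤ |fx| +
      i * (1 / (N : ℝ) * ((‖gx‖ + N * (L * (1 / (N : ℝ) * ‖y - x‖))) * ‖y - x‖)) := by
  set M := ‖gx‖ + N * (L * (1 / (N : ℝ) * ‖y - x‖)) with hM
  have hg : ∀ j, ‖g j‖ ≤ M := fun j => (h.norm_grad_le hL j).trans (by
    have : ((j : ℕ) : ℝ) ≤ N := by exact_mod_cast Nat.lt_succ_iff.mp j.2
    exact add_le_add le_rfl (mul_le_mul_of_nonneg_right this (by positivity)))
  have hb : ∀ j v, ‖v‖ = ‖y - x‖ →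
      |1 / (N : ℝ) * inner ℝ (g j) v| ≤ 1 / (N : ℝ) * (M * ‖y - x‖) := by
    intro j v hv
    rw [abs_mul, abs_of_nonneg (by positivity : 0 ≤ 1 / (N : ℝ))]
    gcongr
    calc |inner ℝ (g j) v| ≤ ‖g j‖ * ‖v‖ := abs_real_inner_le_norm _ _
      _ ≤ M * ‖y - x‖ := by rw [hv]; gcongr; exact hg j
  induction i using Fin.induction with
  | zero => simp [h.value_start]
  | succ i ih =>
    have h1 := h.backward i
    have h2 := h.forward i
    have h3 := hb i.succ (x - y) (norm_sub_rev _ _)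
    have h4 := hb i.castSucc (y - x) rfl
    have h0 : 0 ≤ 1 / (2 * L) * ‖g i.castSucc - g i.succ‖ ^ 2 := by positivity
    simp only [Fin.val_castSucc] at ih
    simp only [Fin.val_succ, Nat.cast_add, Nat.cast_one]
    rw [abs_le] at *
    constructor <;> linarith

/-- The set of feasible points of the program. -/
def feasibleSet (L : ℝ) (N : ℕ) (x : EuclideanSpace ℝ (Fin d)) (fx : ℝ)
    (gx y gy : EuclideanSpace ℝ (Fin d)) :
    Set ((Fin (N + 1) → ℝ) × (Fin (N + 1) → EuclideanSpace ℝ (Fin d))) :=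
  {p | Feasible L N x fx gx y gy p.1 p.2}

theorem isClosed_feasibleSet : IsClosed (feasibleSet L N x fx gx y gy) := by
  have : feasibleSet L N x fx gx y gy =
      (⋂ i : Fin N, {p | 1 / (2 * L) * ‖p.2 i.castSucc - p.2 i.succ‖ ^ 2 ≤
        p.1 i.castSucc - p.1 i.succ - 1 / (N : ℝ) * inner ℝ (p.2 i.succ) (x - y)}) ∩
      (⋂ i : Fin N, {p | 1 / (2 * L) * ‖p.2 i.castSucc - p.2 i.succ‖ ^ 2 ≤
        p.1 i.succ - p.1 i.castSucc - 1 / (N : ℝ) * inner ℝ (p.2 i.castSucc) (y - x)}) ∩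
      {p | p.1 0 = fx} ∩ {p | p.2 0 = gx} ∩ {p | p.2 (Fin.last N) = gy} := by
    ext p
    simp only [feasibleSet, Set.mem_ofPred_eq, Set.mem_inter_iff, Set.mem_iInter]
    exact ⟨fun h => ⟨⟨⟨⟨h.1, h.2⟩, h.3⟩, h.4⟩, h.5⟩,
      fun h => ⟨h.1.1.1.1, h.1.1.1.2, h.1.1.2, h.1.2, h.2⟩⟩
  rw [this]
  refine ((((isClosed_iInter fun i => isClosed_le ?_ ?_).inter
    (isClosed_iInter fun i => isClosed_le ?_ ?_)).inter (isClosed_eq ?_ ?_)).inter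
    (isClosed_eq ?_ ?_)).inter (isClosed_eq ?_ ?_) <;> fun_prop

theorem isCompact_feasibleSet (hL : 0 < L) : IsCompact (feasibleSet L N x fx gx y gy) := by
  refine Metric.isCompact_of_isClosed_isBounded isClosed_feasibleSet ?_
  set A := ‖gx‖ + N * (L * (1 / (N : ℝ) * ‖y - x‖))
  set B := |fx| + N * (1 / (N : ℝ) * (A * ‖y - x‖))
  refine (Metric.isBounded_closedBall (x := 0) (r := max B A)).subset fun p hp => ?_
  have hi : ∀ i : Fin (N + 1), ((i : ℕ) : ℝ) ≤ N := fun i => by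
    exact_mod_cast Nat.lt_succ_iff.mp i.2
  rw [mem_closedBall_zero_iff, Prod.norm_def]
  refine max_le_max ((pi_norm_le_iff_of_nonneg (by positivity)).2 fun i => ?_)
    ((pi_norm_le_iff_of_nonneg (by positivity)).2 fun i => ?_)
  · refine (Feasible.abs_value_le hL hp i).trans ?_
    exact add_le_add le_rfl (mul_le_mul_of_nonneg_right (hi i) (by positivity))
  · refine (Feasible.norm_grad_le hL hp i).trans ?_
    exact add_le_add le_rfl (mul_le_mul_of_nonneg_right (hi i) (by positivity))

theorem feasibleValues_eq_image :
    feasibleValues L N x fx gx y gy =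
      (fun p => p.1 (Fin.last N)) '' feasibleSet L N x fx gx y gy := by
  ext v
  constructor
  · rintro ⟨f, g, h, rfl⟩
    exact ⟨(f, g), h, rfl⟩
  · rintro ⟨p, h, rfl⟩
    exact ⟨p.1, p.2, h, rfl⟩

theorem isCompact_feasibleValues (hL : 0 < L) : IsCompact (feasibleValues L N x fx gx y gy) := by
  rw [feasibleValues_eq_image]
  exact (isCompact_feasibleSet hL).image (by fun_prop)

theorem exists_lowerValue_eq (hL : 0 < L) (h : (feasibleValues L N x fx gx y gy).Nonempty) :
    ∃ b ∈ feasibleValues L N x fx gx y gy, lowerValue L N x fx gx y gy = (b : EReal) := by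
  obtain ⟨b, hb, hmin⟩ := (isCompact_feasibleValues hL).exists_isLeast h
  exact ⟨b, hb, le_antisymm (iInf₂_le b hb)
    (le_iInf₂ fun v hv => EReal.coe_le_coe_iff.2 (hmin hv))⟩

theorem exists_upperValue_eq (hL : 0 < L) (h : (feasibleValues L N x fx gx y gy).Nonempty) :
    ∃ u ∈ feasibleValues L N x fx gx y gy, upperValue L N x fx gx y gy = (u : EReal) := by
  obtain ⟨b, hb, hmax⟩ := (isCompact_feasibleValues hL).exists_isGreatest h
  exact ⟨b, hb, le_antisymm (iSup₂_le fun v hv => EReal.coe_le_coe_iff.2 (hmax hv))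
    (le_iSup₂ (f := fun (v : ℝ) (_ : v ∈ feasibleValues L N x fx gx y gy) => (v : EReal)) b hb)⟩

theorem norm_sq_convexComb_le {E : Type*} [SeminormedAddCommGroup E] [NormedSpace ℝ E]
    {a b : ℝ} (ha : 0 ≤ a) (hb : 0 ≤ b) (hab : a + b = 1) (u v : E) :
    ‖a • u + b • v‖ ^ 2 ≤ a * ‖u‖ ^ 2 + b * ‖v‖ ^ 2 := by
  have h1 : ‖a • u + b • v‖ ≤ a * ‖u‖ + b * ‖v‖ := by
    refine (norm_add_le _ _).trans ?_
    rw [norm_smul, norm_smul, Real.norm_of_nonneg ha, Real.norm_of_nonneg hb]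
  have h2 := pow_le_pow_left₀ (norm_nonneg _) h1 2
  have h3 := (convexOn_pow 2).2 (norm_nonneg u) (norm_nonneg v) ha hb hab
  simp only [smul_eq_mul] at h3
  exact h2.trans h3

theorem convex_feasibleSet (hL : 0 < L) : Convex ℝ (feasibleSet L N x fx gx y gy) := by
  intro p hp q hq a b ha hb hab
  have hn : ∀ i : Fin N, 1 / (2 * L) *
      ‖(a • p + b • q).2 i.castSucc - (a • p + b • q).2 i.succ‖ ^ 2 ≤
      a * (1 / (2 * L) * ‖p.2 i.castSucc - p.2 i.succ‖ ^ 2) +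
      b * (1 / (2 * L) * ‖q.2 i.castSucc - q.2 i.succ‖ ^ 2) := by
    intro i
    have e : (a • p + b • q).2 i.castSucc - (a • p + b • q).2 i.succ =
        a • (p.2 i.castSucc - p.2 i.succ) + b • (q.2 i.castSucc - q.2 i.succ) := by
      simp only [Prod.snd_add, Prod.smul_snd, Pi.add_apply, Pi.smul_apply]
      module
    rw [e]
    have := mul_le_mul_of_nonneg_left (norm_sq_convexComb_le ha hb hab
      (p.2 i.castSucc - p.2 i.succ) (q.2 i.castSucc - q.2 i.succ))
      (by positivity : 0 ≤ 1 / (2 * L))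
    linarith
  have hsmul : ∀ {E : Type} [AddCommGroup E] [Module ℝ E] (v : E), a • v + b • v = v := by
    intro E _ _ v
    rw [← add_smul, hab, one_smul]
  refine ⟨fun i => (hn i).trans ?_, fun i => (hn i).trans ?_, ?_, ?_, ?_⟩
  · have h1 := mul_le_mul_of_nonneg_left (hp.backward i) ha
    have h2 := mul_le_mul_of_nonneg_left (hq.backward i) hb
    simp only [Prod.snd_add, Prod.smul_snd, Prod.fst_add, Prod.smul_fst, Pi.add_apply,
      Pi.smul_apply, inner_add_left, real_inner_smul_left, smul_eq_mul]
    linarith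
  · have h1 := mul_le_mul_of_nonneg_left (hp.forward i) ha
    have h2 := mul_le_mul_of_nonneg_left (hq.forward i) hb
    simp only [Prod.snd_add, Prod.smul_snd, Prod.fst_add, Prod.smul_fst, Pi.add_apply,
      Pi.smul_apply, inner_add_left, real_inner_smul_left, smul_eq_mul]
    linarith
  · simp only [Prod.fst_add, Prod.smul_fst, Pi.add_apply, Pi.smul_apply, hp.value_start,
      hq.value_start, hsmul]
  · simp only [Prod.snd_add, Prod.smul_snd, Pi.add_apply, Pi.smul_apply, hp.grad_start,
      hq.grad_start, hsmul]
  · simp only [Prod.snd_add, Prod.smul_snd, Pi.add_apply, Pi.smul_apply, hp.grad_end,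
      hq.grad_end, hsmul]

theorem convex_feasibleValues (hL : 0 < L) : Convex ℝ (feasibleValues L N x fx gx y gy) := by
  rw [feasibleValues_eq_image]
  exact (convex_feasibleSet hL).is_linear_image
    ⟨fun _ _ => rfl, fun _ _ => rfl⟩

/-- Every real number between the two optimal values is the objective value of a feasible
point. -/
theorem mem_feasibleValues_of_between (hL : 0 < L) {v : ℝ}
    (h1 : lowerValue L N x fx gx y gy ≤ (v : EReal))
    (h2 : (v : EReal) ≤ upperValue L N x fx gx y gy) : v ∈ feasibleValues L N x fx gx y gy := by
  rcases (feasibleValues L N x fx gx y gy).eq_empty_or_nonempty with h | h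
  -- An infeasible program has upper value `⊥`, which no real number is below.
  · simp [upperValue, h] at h2
  · obtain ⟨b, hb, hb'⟩ := exists_lowerValue_eq hL h
    obtain ⟨u, hu, hu'⟩ := exists_upperValue_eq hL h
    rw [hb', EReal.coe_le_coe_iff] at h1
    rw [hu', EReal.coe_le_coe_iff] at h2
    exact (convex_feasibleValues hL).ordConnected.out hb hu ⟨h1, h2⟩

end Program

/-! ### The descent lemma -/

section Interpolation

variable {E : Type*} [NormedAddCommGroup E] [InnerProductSpace ℝ E] [CompleteSpace E]

/-- The descent lemma along a segment. -/
theorem le_quadratic_of_lipschitz_gradient {L : ℝ} {f : E → ℝ} {u w : E}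
    (hd : ∀ z ∈ segment ℝ u w, DifferentiableAt ℝ f z)
    (hs : ∀ z ∈ segment ℝ u w, ‖gradient f z - gradient f u‖ ≤ L * ‖z - u‖) :
    f w ≤ f u + inner ℝ (gradient f u) (w - u) + L / 2 * ‖w - u‖ ^ 2 := by
  set ψ : ℝ → ℝ := fun t =>
    f (u + t • (w - u)) - t * inner ℝ (gradient f u) (w - u) - L / 2 * ‖w - u‖ ^ 2 * t ^ 2
  have hmem : ∀ t ∈ Set.Icc (0 : ℝ) 1, u + t • (w - u) ∈ segment ℝ u w := fun t ht => by
    rw [segment_eq_image']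
    exact ⟨t, ht, rfl⟩
  have hderiv : ∀ t ∈ Set.Icc (0 : ℝ) 1, HasDerivAt ψ
      (inner ℝ (gradient f (u + t • (w - u))) (w - u) - inner ℝ (gradient f u) (w - u)
        - L / 2 * ‖w - u‖ ^ 2 * (2 * t)) t := by
    intro t ht
    have h1 : HasDerivAt (fun t : ℝ => u + t • (w - u)) (w - u) t := by
      simpa using ((hasDerivAt_id t).smul_const (w - u)).const_add u
    have h2 := (hd _ (hmem t ht)).hasGradientAt.hasFDerivAt.comp_hasDerivAt t h1
    have h3 := (hasDerivAt_id t).mul_const (inner ℝ (gradient f u) (w - u))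
    have h4 := ((hasDerivAt_id t).pow 2).const_mul (L / 2 * ‖w - u‖ ^ 2)
    refine ((h2.sub h3).sub h4).congr_deriv ?_
    simp
  -- `ψ` is `f` along the segment minus the linear and quadratic terms of the bound; the Lipschitz
  -- estimate from `u` makes its derivative nonpositive.
  have hanti : AntitoneOn ψ (Set.Icc 0 1) := by
    refine antitoneOn_of_deriv_nonpos (convex_Icc 0 1)
      (fun t ht => (hderiv t ht).continuousAt.continuousWithinAt)
      (fun t ht => (hderiv t (interior_subset ht)).differentiableAt.differentiableWithinAt)
      fun t ht => ?_
    have ht' := interior_subset ht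
    rw [(hderiv t ht').deriv, ← inner_sub_left]
    have h1 := real_inner_le_norm (gradient f (u + t • (w - u)) - gradient f u) (w - u)
    have h2 := hs _ (hmem t ht')
    rw [add_sub_cancel_left, norm_smul, Real.norm_of_nonneg ht'.1] at h2
    have h3 := mul_le_mul_of_nonneg_right h2 (norm_nonneg (w - u))
    linarith
  have := hanti (Set.left_mem_Icc.2 zero_le_one) (Set.right_mem_Icc.2 zero_le_one) zero_le_one
  simp only [ψ, one_smul, zero_smul, add_zero, add_sub_cancel] at this
  linarith

end Interpolation

/-! ### Part 1: sampling a smooth convex function -/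

variable {d : ℕ} {L : ℝ}

/-- The interpolation inequality of smooth convex functions holds for points whose distance is
small compared to the distance to the boundary. -/
theorem interpolation_inequality {C : Set (EuclideanSpace ℝ (Fin d))}
    {f : EuclideanSpace ℝ (Fin d) → ℝ} (hL : 0 < L) (hC : IsOpen C) (hconv : Convex ℝ C)
    (hd : DifferentiableOn ℝ f C) (hs : SmoothOver L f C) (hc : ConvexOver f C)
    {u v : EuclideanSpace ℝ (Fin d)} (hv : v ∈ C)
    (hball : Metric.closedBall u ‖u - v‖ ⊆ C) :
    1 / (2 * L) * ‖gradient f u - gradient f v‖ ^ 2 ≤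
      f u - f v - inner ℝ (gradient f v) (u - v) := by
  have hu : u ∈ C := hball (Metric.mem_closedBall_self (norm_nonneg _))
  set δ := gradient f u - gradient f v with hδ
  -- A gradient step from `u` for `f` minus its linear part at `v`. Convexity bounds `f w` below
  -- from `v`, the descent lemma bounds it above from `u`.
  set w := u - (1 / L) • δ with hw
  have hwC : w ∈ C := by
    refine hball ?_
    rw [mem_closedBall_iff_norm, hw, sub_sub_cancel_left, norm_neg, norm_smul,
      Real.norm_of_nonneg (by positivity)]
    calc 1 / L * ‖δ‖ ≤ 1 / L * (L * ‖u - v‖) := by gcongr; exact hs u hu v hv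
      _ = ‖u - v‖ := by field_simp
  have hseg : segment ℝ u w ⊆ C := hconv.segment_subset hu hwC
  have h1 := le_quadratic_of_lipschitz_gradient
    (fun z hz => (hd z (hseg hz)).differentiableAt (hC.mem_nhds (hseg hz)))
    (fun z hz => hs z (hseg hz) u hu)
  have h2 := hc v hv w hwC
  have e1 : w - u = -((1 / L) • δ) := by rw [hw]; abel
  have e2 : w - v = (u - v) - (1 / L) • δ := by rw [hw]; abel
  rw [e1, norm_neg, norm_smul, Real.norm_of_nonneg (by positivity), inner_neg_right,
    real_inner_smul_right] at h1
  rw [e2, inner_sub_right, real_inner_smul_right] at h2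
  have h3 : inner ℝ (gradient f u) δ - inner ℝ (gradient f v) δ = ‖δ‖ ^ 2 := by
    rw [← inner_sub_left, ← hδ, real_inner_self_eq_norm_sq]
  have h4 : 1 / L * inner ℝ (gradient f u) δ - 1 / L * inner ℝ (gradient f v) δ
      = 1 / L * ‖δ‖ ^ 2 := by rw [← h3]; ring
  have h5 : L / 2 * (1 / L * ‖δ‖) ^ 2 = 1 / (2 * L) * ‖δ‖ ^ 2 := by field_simp
  have h6 : 1 / L * ‖δ‖ ^ 2 = 2 * (1 / (2 * L) * ‖δ‖ ^ 2) := by field_simp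
  linarith

theorem mem_of_dist_lt_infDist_compl {X : Type*} [PseudoMetricSpace X] {C : Set X} {x z : X}
    (h : dist z x < Metric.infDist x Cᶜ) : z ∈ C := by
  by_contra hz
  exact absurd (Metric.infDist_le_dist_of_mem (x := x) (Set.mem_compl hz))
    (by rw [dist_comm] at h; exact not_le.2 h)

/-- A displacement of a point of the segment is the same convex combination of the displaced
endpoints, which remain in `C`. -/
theorem closedBall_subset_of_mem_segment {C : Set (EuclideanSpace ℝ (Fin d))}
    (hconv : Convex ℝ C) {x y u : EuclideanSpace ℝ (Fin d)} (hu : u ∈ segment ℝ x y) {r : ℝ}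
    (hr : r < min (Metric.infDist x Cᶜ) (Metric.infDist y Cᶜ)) : Metric.closedBall u r ⊆ C := by
  intro w hw
  obtain ⟨a, b, ha, hb, hab, rfl⟩ := hu
  set δ := w - (a • x + b • y) with hδ
  rw [mem_closedBall_iff_norm] at hw
  have hw' := hw.trans_lt hr
  have hx : x + δ ∈ C := mem_of_dist_lt_infDist_compl (by
    rw [dist_eq_norm, add_sub_cancel_left]; exact hw'.trans_le (min_le_left _ _))
  have hy : y + δ ∈ C := mem_of_dist_lt_infDist_compl (by
    rw [dist_eq_norm, add_sub_cancel_left]; exact hw'.trans_le (min_le_right _ _))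
  have e : w = a • (x + δ) + b • (y + δ) := by
    calc w = a • x + b • y + (a + b) • δ := by rw [hab, one_smul, hδ]; abel
      _ = _ := by module
  rw [e]
  exact hconv hx hy ha hb hab

/-- The value of a smooth convex function at `y` is attained in the program once the step is
short compared to the distance to the boundary. -/
theorem mem_feasibleValues_of_smooth_convex {C : Set (EuclideanSpace ℝ (Fin d))}
    {f : EuclideanSpace ℝ (Fin d) → ℝ} (hL : 0 < L) (hC : IsOpen C) (hconv : Convex ℝ C)
    (hne : C ≠ Set.univ) (hd : DifferentiableOn ℝ f C) (hs : SmoothOver L f C)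
    (hc : ConvexOver f C) {x y : EuclideanSpace ℝ (Fin d)} (hx : x ∈ C) (hy : y ∈ C) {N : ℕ}
    (hN : ‖y - x‖ / min (Metric.infDist x Cᶜ) (Metric.infDist y Cᶜ) < (N : ℝ)) :
    f y ∈ feasibleValues L N x (f x) (gradient f x) y (gradient f y) := by
  -- `Metric.infDist` to the empty set is `0`, so the positivity relies on `C` being proper.
  have hpos : ∀ z ∈ C, 0 < Metric.infDist z Cᶜ := fun z hz =>
    (hC.isClosed_compl.notMem_iff_infDist_pos (Set.nonempty_compl.2 hne)).1 (by simpa using hz)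
  have hm : 0 < min (Metric.infDist x Cᶜ) (Metric.infDist y Cᶜ) := lt_min (hpos x hx) (hpos y hy)
  have hN0 : 0 < (N : ℝ) := (div_nonneg (norm_nonneg _) hm.le).trans_lt hN
  have hr : 1 / (N : ℝ) * ‖y - x‖ < min (Metric.infDist x Cᶜ) (Metric.infDist y Cᶜ) := by
    rw [div_lt_iff₀ hm] at hN
    rw [one_div, inv_mul_lt_iff₀ hN0]
    exact hN
  set p : Fin (N + 1) → EuclideanSpace ℝ (Fin d) := fun i => x + ((i : ℝ) / N) • (y - x)
  have hp : ∀ i, p i ∈ segment ℝ x y := fun i => by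
    rw [segment_eq_image']
    refine ⟨_, ⟨by positivity, ?_⟩, rfl⟩
    rw [div_le_one hN0]
    exact_mod_cast Nat.lt_succ_iff.mp i.2
  have hpC : ∀ i, p i ∈ C := fun i => hconv.segment_subset hx hy (hp i)
  have hstep : ∀ i : Fin N, p i.succ - p i.castSucc = (1 / (N : ℝ)) • (y - x) := fun i => by
    simp only [p, Fin.val_succ, Fin.val_castSucc, Nat.cast_add, Nat.cast_one, add_div]
    module
  have hstep' : ∀ i : Fin N, p i.castSucc - p i.succ = (1 / (N : ℝ)) • (x - y) := fun i => by
    rw [← neg_sub, hstep, ← smul_neg, neg_sub]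
  have h0 : p 0 = x := by simp [p]
  have hlast : p (Fin.last N) = y := by simp [p, hN0.ne']
  refine ⟨fun i => f (p i), fun i => gradient f (p i), ⟨fun i => ?_, fun i => ?_, ?_, ?_, ?_⟩, ?_⟩
  · rw [← real_inner_smul_right, ← hstep' i]
    refine interpolation_inequality hL hC hconv hd hs hc (hpC _)
      (closedBall_subset_of_mem_segment hconv (hp _) ?_)
    rwa [hstep', norm_smul, Real.norm_of_nonneg (by positivity), norm_sub_rev]
  · rw [← real_inner_smul_right, ← hstep i, norm_sub_rev]
    refine interpolation_inequality hL hC hconv hd hs hc (hpC _)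
      (closedBall_subset_of_mem_segment hconv (hp _) ?_)
    rwa [hstep, norm_smul, Real.norm_of_nonneg (by positivity)]
  all_goals simp only [h0, hlast]

/-! ### Gradient paths with prescribed increments -/

section Path

/-- The piecewise linear ramp that rises from `0` to `1` with slope `K`, starting at `σ`. -/
noncomputable def ramp (K σ t : ℝ) : ℝ := min 1 (max 0 (K * (t - σ)))

theorem ramp_monotone {K : ℝ} (hK : 0 ≤ K) (σ : ℝ) : Monotone (ramp K σ) := fun s t hst => by
  unfold ramp
  gcongr

theorem continuous_ramp (K σ : ℝ) : Continuous (ramp K σ) := by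
  unfold ramp
  fun_prop

theorem abs_ramp_sub_le {K : ℝ} (hK : 0 ≤ K) (σ s t : ℝ) :
    |ramp K σ s - ramp K σ t| ≤ K * |s - t| := by
  refine (abs_min_sub_min_le_max _ _ _ _).trans ?_
  rw [sub_self, abs_zero]
  refine max_le (by positivity) ((abs_max_sub_max_le_max _ _ _ _).trans ?_)
  rw [sub_self, abs_zero]
  refine max_le (by positivity) ?_
  rw [← mul_sub, sub_sub_sub_cancel_right, abs_mul, abs_of_nonneg hK]

theorem ramp_of_le {K σ t : ℝ} (hK : 0 ≤ K) (h : t ≤ σ) : ramp K σ t = 0 := by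
  have : K * (t - σ) ≤ 0 := mul_nonpos_of_nonneg_of_nonpos hK (by linarith)
  simp [ramp, this]

theorem ramp_of_ge {K σ t : ℝ} (hK : 0 < K) (h : σ + 1 / K ≤ t) : ramp K σ t = 1 := by
  have : 1 ≤ K * (t - σ) := by
    calc (1 : ℝ) = K * (1 / K) := by field_simp
      _ ≤ _ := by gcongr; linarith
  rw [ramp, max_eq_right (by linarith), min_eq_left this]

theorem ramp_of_mem {K σ t : ℝ} (hK : 0 < K) (h1 : σ ≤ t) (h2 : t ≤ σ + 1 / K) :
    ramp K σ t = K * (t - σ) := by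
  have : K * (t - σ) ≤ 1 := by
    calc K * (t - σ) ≤ K * (1 / K) := by gcongr; linarith
      _ = 1 := by field_simp
  rw [ramp, max_eq_right (mul_nonneg hK.le (by linarith)), min_eq_right this]

/-- The ramp has the same area as a unit jump at its midpoint, so sliding `σ` tunes the integral. -/
theorem integral_ramp {K σ : ℝ} (hK : 0 < K) (h0 : 0 ≤ σ) (h1 : σ + 1 / K ≤ 1) :
    ∫ t in (0 : ℝ)..1, ramp K σ t = 1 - σ - 1 / (2 * K) := by
  have hi : ∀ a b, IntervalIntegrable (ramp K σ) MeasureTheory.volume a b := fun a b =>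
    (continuous_ramp K σ).intervalIntegrable a b
  have hK' : 0 < 1 / K := by positivity
  rw [← intervalIntegral.integral_add_adjacent_intervals (hi 0 σ) (hi σ 1),
    ← intervalIntegral.integral_add_adjacent_intervals (hi σ (σ + 1 / K)) (hi (σ + 1 / K) 1)]
  have e1 : ∫ t in (0 : ℝ)..σ, ramp K σ t = 0 := by
    rw [intervalIntegral.integral_congr (g := fun _ => (0 : ℝ)) fun t ht => ?_]
    · simp
    · rw [Set.uIcc_of_le h0] at ht
      exact ramp_of_le hK.le ht.2
  have e2 : ∫ t in σ..(σ + 1 / K), ramp K σ t = 1 / (2 * K) := by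
    rw [intervalIntegral.integral_congr (g := fun t => K * (t - σ)) fun t ht => ?_]
    · rw [intervalIntegral.integral_const_mul,
        intervalIntegral.integral_comp_sub_right (fun t => t) σ]
      simp
      field_simp
    · rw [Set.uIcc_of_le (by linarith)] at ht
      exact ramp_of_mem hK ht.1 ht.2
  have e3 : ∫ t in (σ + 1 / K)..1, ramp K σ t = 1 - σ - 1 / K := by
    rw [intervalIntegral.integral_congr (g := fun _ => (1 : ℝ)) fun t ht => ?_]
    · simp; ring
    · rw [Set.uIcc_of_le h1] at ht
      exact ramp_of_ge hK ht.1
  rw [e1, e2, e3]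
  field_simp
  ring

/-- Gluing two Lipschitz estimates at a common point. -/
theorem norm_sub_le_of_glue {E : Type*} [SeminormedAddCommGroup E] {K c : ℝ} {G : ℝ → E}
    (h1 : ∀ s t, s ≤ t → t ≤ c → ‖G s - G t‖ ≤ K * (t - s))
    (h2 : ∀ s t, c ≤ s → s ≤ t → ‖G s - G t‖ ≤ K * (t - s)) {s t : ℝ} (hst : s ≤ t) :
    ‖G s - G t‖ ≤ K * (t - s) := by
  rcases le_total t c with h | h
  · exact h1 s t hst h
  rcases le_total c s with h' | h'
  · exact h2 s t h' hst
  · have := norm_sub_le_norm_sub_add_norm_sub (G s) (G c) (G t)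
    have := h1 s c h' le_rfl
    have := h2 c t le_rfl h
    linarith

variable {E : Type*} [NormedAddCommGroup E] [InnerProductSpace ℝ E]

/-- A profile interpolating between two gradients with prescribed total increment. -/
theorem exists_profile {L : ℝ} (hL : 0 < L) {h Δ : E} {c : ℝ}
    (h1 : 1 / (2 * L) * ‖Δ‖ ^ 2 ≤ c) (h2 : 1 / (2 * L) * ‖Δ‖ ^ 2 ≤ inner ℝ Δ h - c) :
    ∃ a : ℝ → ℝ, Continuous a ∧ Monotone a ∧ (∀ t ≤ 0, a t = 0) ∧ (∀ t, 1 ≤ t → a t = 1) ∧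
      (∀ s t, ‖Δ‖ * |a s - a t| ≤ L * ‖h‖ * |s - t|) ∧
      (∫ t in (0 : ℝ)..1, a t) * inner ℝ Δ h = c := by
  rcases eq_or_ne Δ 0 with rfl | hΔ
  -- With `Δ = 0` the hypotheses force `c = 0`, and any ramp will do.
  · refine ⟨ramp 1 0, continuous_ramp 1 0, ramp_monotone zero_le_one 0,
      fun t ht => ramp_of_le zero_le_one ht, fun t ht => ramp_of_ge one_pos (by simpa using ht),
      fun s t => ?_, ?_⟩
    · simp only [norm_zero, zero_mul]
      positivity
    · simp at h1 h2 ⊢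
      linarith
  · have hD : 0 < ‖Δ‖ := norm_pos_iff.2 hΔ
    have hin : 1 / L * ‖Δ‖ ^ 2 ≤ inner ℝ Δ h := by
      have e : 1 / L * ‖Δ‖ ^ 2 = 2 * (1 / (2 * L) * ‖Δ‖ ^ 2) := by field_simp
      linarith
    have hpos : 0 < inner ℝ Δ h := lt_of_lt_of_le (by positivity) hin
    have hcs := real_inner_le_norm Δ h
    have hh : 0 < ‖h‖ := by
      by_contra hc
      have : ‖h‖ = 0 := le_antisymm (not_lt.1 hc) (norm_nonneg _)
      rw [this, mul_zero] at hcs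
      linarith
    -- The steepest slope compatible with the Lipschitz bound. By Cauchy–Schwarz, the two hypotheses
    -- then confine the required mean `m` to the range of means of ramps that fit in the unit
    -- interval.
    set K := L * ‖h‖ / ‖Δ‖ with hKdef
    have hK : 0 < K := by positivity
    have hbound : 1 / (2 * K) * inner ℝ Δ h ≤ 1 / (2 * L) * ‖Δ‖ ^ 2 := by
      calc 1 / (2 * K) * inner ℝ Δ h ≤ 1 / (2 * K) * (‖Δ‖ * ‖h‖) := by gcongr
        _ = _ := by rw [hKdef]; field_simp
    set m := c / inner ℝ Δ h with hm
    have hm1 : 1 / (2 * K) ≤ m := by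
      rw [hm, le_div_iff₀ hpos]
      linarith
    have hm2 : m ≤ 1 - 1 / (2 * K) := by
      rw [hm, div_le_iff₀ hpos]
      linarith
    have hKK : 1 / K = 1 / (2 * K) + 1 / (2 * K) := by field_simp; norm_num
    have hσ : 0 ≤ 1 - m - 1 / (2 * K) := by linarith
    have hσ' : 1 - m - 1 / (2 * K) + 1 / K ≤ 1 := by linarith
    refine ⟨ramp K (1 - m - 1 / (2 * K)), continuous_ramp _ _, ramp_monotone hK.le _,
      fun t ht => ramp_of_le hK.le (ht.trans hσ), fun t ht => ramp_of_ge hK (hσ'.trans ht),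
      fun s t => ?_, ?_⟩
    · calc ‖Δ‖ * |ramp K (1 - m - 1 / (2 * K)) s - ramp K (1 - m - 1 / (2 * K)) t|
          ≤ ‖Δ‖ * (K * |s - t|) := by gcongr; exact abs_ramp_sub_le hK.le _ _ _
        _ = L * ‖h‖ * |s - t| := by rw [hKdef]; field_simp
    · rw [integral_ramp hK hσ hσ']
      have : 1 - (1 - m - 1 / (2 * K)) - 1 / (2 * K) = m := by ring
      rw [this, hm, div_mul_cancel₀ _ hpos.ne']

/-- A Lipschitz gradient path along a line through given nodes, monotone in the direction of the
line and with prescribed increments of the potential. -/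
theorem exists_gradient_path {L : ℝ} (hL : 0 < L) (h : E) (f : ℕ → ℝ) (g : ℕ → E) (n : ℕ)
    (hb : ∀ i < n, 1 / (2 * L) * ‖g i - g (i + 1)‖ ^ 2 ≤
      f i - f (i + 1) + inner ℝ (g (i + 1)) h)
    (hf : ∀ i < n, 1 / (2 * L) * ‖g i - g (i + 1)‖ ^ 2 ≤ f (i + 1) - f i - inner ℝ (g i) h) :
    ∃ G : ℝ → E, Continuous G ∧ (∀ s t, s ≤ t → ‖G s - G t‖ ≤ L * ‖h‖ * (t - s)) ∧
      Monotone (fun t => inner ℝ (G t) h) ∧ G 0 = g 0 ∧ (∀ t, (n : ℝ) ≤ t → G t = g n) ∧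
      ∫ t in (0 : ℝ)..n, inner ℝ (G t) h = f n - f 0 := by
  induction n with
  | zero =>
    refine ⟨fun _ => g 0, continuous_const, fun s t hst => ?_, monotone_const, rfl,
      fun _ _ => rfl, by simp⟩
    rw [sub_self, norm_zero]
    exact mul_nonneg (by positivity) (by linarith)
  | succ n ih =>
    obtain ⟨G, hGc, hGl, hGm, hG0, hGn, hGi⟩ := ih (fun i hi => hb i (by omega))
      (fun i hi => hf i (by omega))
    set Δ := g (n + 1) - g n with hΔ
    have e1 := hb n (by omega)
    have e2 := hf n (by omega)
    rw [norm_sub_rev, ← hΔ] at e1 e2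
    obtain ⟨a, hac, ham, ha0, ha1, hal, hai⟩ := exists_profile hL (h := h) (Δ := Δ)
      (c := f (n + 1) - f n - inner ℝ (g n) h) e2 (by
        rw [hΔ, inner_sub_left] at *; linarith)
    have hΔh : 0 ≤ inner ℝ Δ h := by
      have : 0 ≤ 1 / (2 * L) * ‖Δ‖ ^ 2 := by positivity
      rw [hΔ, inner_sub_left] at *
      linarith
    have hac' : Continuous fun t : ℝ => a (t - n) := hac.comp (by fun_prop)
    -- Up to `n` the new term vanishes, and from `n` on `G` is constant, so the Lipschitz constants
    -- do not add up.
    have hc : Continuous fun t => G t + a (t - n) • Δ := hGc.add (hac'.smul continuous_const)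
    refine ⟨fun t => G t + a (t - n) • Δ, hc, fun s t hst => ?_, ?_, ?_, fun t ht => ?_, ?_⟩
    · refine norm_sub_le_of_glue (c := n) (G := fun t => G t + a (t - n) • Δ)
        (fun s t hst ht => ?_) (fun s t hs hst => ?_) hst
      · simp only [ha0 (s - n) (by linarith), ha0 (t - n) (by linarith), zero_smul, add_zero]
        exact hGl s t hst
      · simp only [hGn s hs, hGn t (hs.trans hst)]
        rw [add_sub_add_left_eq_sub, ← sub_smul, norm_smul, Real.norm_eq_abs, mul_comm]
        refine (hal _ _).trans_eq ?_
        rw [sub_sub_sub_cancel_right, abs_sub_comm, abs_of_nonneg (by linarith)]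
    · simp only [inner_add_left, real_inner_smul_left]
      refine hGm.add fun s t hst => mul_le_mul_of_nonneg_right (ham (by linarith)) hΔh
    · simp only [hG0, ha0 (0 - n) (by simp), zero_smul, add_zero]
    · push_cast at ht
      simp only [hGn t (by linarith), ha1 (t - n) (by linarith), one_smul, hΔ]
      abel
    · have hint : ∀ u v, IntervalIntegrable (fun t => inner ℝ (G t + a (t - n) • Δ) h)
          MeasureTheory.volume u v := fun u v =>
        (hc.inner continuous_const).intervalIntegrable u v
      rw [← intervalIntegral.integral_add_adjacent_intervals (hint 0 n) (hint n _)]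
      have i1 : ∫ t in (0 : ℝ)..n, inner ℝ (G t + a (t - n) • Δ) h = f n - f 0 := by
        rw [← hGi]
        refine intervalIntegral.integral_congr fun t ht => ?_
        rw [Set.uIcc_of_le (Nat.cast_nonneg n)] at ht
        simp only [ha0 (t - n) (by linarith [ht.2]), zero_smul, add_zero]
      have i2 : ∫ t in (n : ℝ)..((n + 1 : ℕ) : ℝ), inner ℝ (G t + a (t - n) • Δ) h =
          f (n + 1) - f n := by
        rw [intervalIntegral.integral_congr
          (g := fun t => inner ℝ (g n) h + a (t - n) * inner ℝ Δ h) fun t ht => ?_]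
        · have hi : IntervalIntegrable (fun t : ℝ => a (t - n) * inner ℝ Δ h)
              MeasureTheory.volume (n : ℝ) ((n + 1 : ℕ) : ℝ) :=
            (hac'.mul continuous_const).intervalIntegrable _ _
          rw [intervalIntegral.integral_add intervalIntegrable_const hi,
            intervalIntegral.integral_mul_const,
            intervalIntegral.integral_comp_sub_right a (n : ℝ)]
          simp [hai]
        · rw [Set.uIcc_of_le (by simp)] at ht
          simp only [hGn t ht.1, inner_add_left, real_inner_smul_left]
      rw [i1, i2]
      ring

end Path

/-! ### Extending from a line to the whole space -/

section Extension

variable {E : Type*} [NormedAddCommGroup E] [InnerProductSpace ℝ E]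

/-- The coordinate along `h`, normalized to be `1` at `h`. -/
noncomputable def lineCoord (h : E) : E →L[ℝ] ℝ := (1 / ‖h‖ ^ 2) • innerSL ℝ h

/-- The component orthogonal to `h`. -/
noncomputable def lineOrth (h : E) : E →L[ℝ] E :=
  ContinuousLinearMap.id ℝ E - (lineCoord h).smulRight h

theorem lineCoord_self {h : E} (hh : h ≠ 0) : lineCoord h h = 1 := by
  have : ‖h‖ ≠ 0 := norm_ne_zero_iff.2 hh
  simp [lineCoord, this]

theorem lineOrth_apply (h v : E) : lineOrth h v = v - lineCoord h v • h := rfl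

theorem lineOrth_self {h : E} (hh : h ≠ 0) : lineOrth h h = 0 := by
  rw [lineOrth_apply, lineCoord_self hh, one_smul, sub_self]

/-- The transversal part of the extension: on the axis its gradient is the component of the
derivative of `Ψ` orthogonal to `h`, and off the axis it is as regular as `Ψ`. -/
noncomputable def transversal (Ψ : ℝ → E) (h z : E) : ℝ :=
  inner ℝ (Ψ (lineCoord h z + ‖lineOrth h z‖ ^ 2) - Ψ (lineCoord h z)) (lineOrth h z) /
    ‖lineOrth h z‖ ^ 2

theorem transversal_of_lineOrth_eq_zero (Ψ : ℝ → E) {h z : E} (hz : lineOrth h z = 0) :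
    transversal Ψ h z = 0 := by
  simp [transversal, hz]

theorem differentiableAt_transversal {Ψ : ℝ → E} (hΨ : Differentiable ℝ Ψ) {h z : E}
    (hz : lineOrth h z ≠ 0) : DifferentiableAt ℝ (transversal Ψ h) z := by
  have hw : DifferentiableAt ℝ (fun z => lineOrth h z) z := (lineOrth h).differentiableAt
  have ht : DifferentiableAt ℝ (fun z => lineCoord h z) z := (lineCoord h).differentiableAt
  have h1 : DifferentiableAt ℝ (fun z => lineCoord h z + ‖lineOrth h z‖ ^ 2) z :=
    ht.add (hw.norm_sq ℝ)
  have h2 : DifferentiableAt ℝ (fun z => Ψ (lineCoord h z + ‖lineOrth h z‖ ^ 2)) z :=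
    (hΨ _).comp z h1
  have h3 : DifferentiableAt ℝ (fun z => Ψ (lineCoord h z)) z := (hΨ _).comp z ht
  have h4 : ‖lineOrth h z‖ ^ 2 ≠ 0 := pow_ne_zero 2 (norm_ne_zero_iff.2 hz)
  have h5 : DifferentiableAt ℝ (fun z => (‖lineOrth h z‖ ^ 2)⁻¹) z := (hw.norm_sq ℝ).fun_inv h4
  exact ((h2.sub h3).inner ℝ hw).fun_mul h5

/-- Base point and increment of the difference quotient both vary with the point, hence strict
differentiability. With `w` the orthogonal component, the error in `Ψ` is `o(‖w‖ ^ 2)`; pairing with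
`w` and dividing by `‖w‖ ^ 2` leaves `o(‖w‖)`. -/
theorem hasFDerivAt_transversal {Ψ : ℝ → E} {h z : E} {γ : E} (hz : lineOrth h z = 0)
    (hΨ : HasStrictDerivAt Ψ γ (lineCoord h z)) :
    HasFDerivAt (transversal Ψ h) ((innerSL ℝ γ).comp (lineOrth h)) z := by
  have hlim : Filter.Tendsto (fun u => (lineCoord h u + ‖lineOrth h u‖ ^ 2, lineCoord h u))
      (nhds z) (nhds (lineCoord h z, lineCoord h z)) := by
    have : Continuous fun u => (lineCoord h u + ‖lineOrth h u‖ ^ 2, lineCoord h u) := by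
      fun_prop
    have := this.tendsto z
    rwa [hz, norm_zero, zero_pow two_ne_zero, add_zero] at this
  have ho := hΨ.hasStrictFDerivAt.isLittleO.comp_tendsto hlim
  rw [hasFDerivAt_iff_isLittleO, Asymptotics.isLittleO_iff]
  intro c hc
  set M := ‖lineOrth h‖ + 1
  have hM : 0 < M := by positivity
  filter_upwards [Asymptotics.isLittleO_iff.1 ho (c := c / M) (by positivity)] with u hu
  have hw : lineOrth h (u - z) = lineOrth h u := by rw [map_sub, hz, sub_zero]
  rw [transversal_of_lineOrth_eq_zero Ψ hz, ContinuousLinearMap.comp_apply, hw, sub_zero,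
    innerSL_apply_apply]
  have hwn : ‖lineOrth h u‖ ≤ M * ‖u - z‖ := by
    rw [← hw]
    refine ((lineOrth h).le_opNorm _).trans ?_
    gcongr
    simp [M]
  rcases eq_or_ne (lineOrth h u) 0 with h0 | h0
  · rw [transversal_of_lineOrth_eq_zero Ψ h0, h0]
    simp
    positivity
  · have hp : 0 < ‖lineOrth h u‖ := norm_pos_iff.2 h0
    simp only [Function.comp_apply, add_sub_cancel_left, ContinuousLinearMap.toSpanSingleton_apply,
      norm_pow, norm_norm] at hu
    set w := lineOrth h u
    set D := Ψ (lineCoord h u + ‖w‖ ^ 2) - Ψ (lineCoord h u)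
    have e : transversal Ψ h u - inner ℝ γ w = inner ℝ (D - ‖w‖ ^ 2 • γ) w / ‖w‖ ^ 2 := by
      rw [inner_sub_left, real_inner_smul_left, sub_div, mul_div_cancel_left₀ _ (by positivity)]
      rfl
    rw [e, norm_div, norm_pow, norm_norm, div_le_iff₀ (by positivity)]
    calc ‖inner ℝ (D - ‖w‖ ^ 2 • γ) w‖ ≤ ‖D - ‖w‖ ^ 2 • γ‖ * ‖w‖ := norm_inner_le_norm _ _
      _ ≤ (c / M * ‖w‖ ^ 2) * (M * ‖u - z‖) := by gcongr
      _ = c * ‖u - z‖ * ‖w‖ ^ 2 := by field_simp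

/-- Extension from the line `ℝ h` to the whole space of a function with a prescribed continuous
gradient on the line. -/
noncomputable def lineExtension (Ψ : ℝ → E) (h z : E) : ℝ :=
  inner ℝ (Ψ (lineCoord h z)) h + transversal Ψ h z

theorem lineExtension_smul {Ψ : ℝ → E} {h : E} (hh : h ≠ 0) (t : ℝ) :
    lineExtension Ψ h (t • h) = inner ℝ (Ψ t) h := by
  rw [lineExtension, transversal_of_lineOrth_eq_zero _ (by rw [map_smul, lineOrth_self hh,
    smul_zero]), map_smul, lineCoord_self hh, smul_eq_mul, mul_one, add_zero]

variable [CompleteSpace E]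

/-- The first summand supplies the pairing of `γ` with the component of a vector along `h`, the
transversal part the pairing with its orthogonal component. -/
theorem hasGradientAt_lineExtension {Ψ : ℝ → E} {h : E} (hh : h ≠ 0) {t : ℝ} {γ : E}
    (hΨ : HasStrictDerivAt Ψ γ t) : HasGradientAt (lineExtension Ψ h) γ (t • h) := by
  have ht : lineCoord h (t • h) = t := by
    rw [map_smul, lineCoord_self hh, smul_eq_mul, mul_one]
  have hw : lineOrth h (t • h) = 0 := by rw [map_smul, lineOrth_self hh, smul_zero]
  rw [← ht] at hΨ
  have h1 : HasFDerivAt (fun z => Ψ (lineCoord h z)) _ (t • h) :=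
    hΨ.hasDerivAt.hasFDerivAt.comp (t • h) (lineCoord h).hasFDerivAt
  have h2 := h1.inner ℝ (hasFDerivAt_const h (t • h))
  rw [hasGradientAt_iff_hasFDerivAt]
  refine (h2.add (hasFDerivAt_transversal hw hΨ)).congr_fderiv ?_
  ext v
  simp [lineOrth_apply, inner_sub_right, real_inner_smul_left, real_inner_smul_right,
    fderivInnerCLM_apply]

theorem differentiable_lineExtension {Ψ G : ℝ → E} {h : E} (hh : h ≠ 0)
    (hΨ : ∀ t, HasStrictDerivAt Ψ (G t) t) : Differentiable ℝ (lineExtension Ψ h) := by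
  intro z
  by_cases hz : lineOrth h z = 0
  · have : z = lineCoord h z • h := by rwa [lineOrth_apply, sub_eq_zero] at hz
    rw [this]
    exact (hasGradientAt_lineExtension hh (hΨ _)).differentiableAt
  · have hd : Differentiable ℝ Ψ := fun t => (hΨ t).hasDerivAt.differentiableAt
    have h1 : DifferentiableAt ℝ (fun z => Ψ (lineCoord h z)) z :=
      (hd _).comp z (lineCoord h).differentiableAt
    exact (h1.inner ℝ (differentiableAt_const h)).add (differentiableAt_transversal hd hz)

/-- A real function with monotone derivative lies above its tangents. -/
theorem tangent_le_of_monotone_deriv {φ φ' : ℝ → ℝ} (hφ : ∀ t, HasDerivAt φ (φ' t) t)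
    (hm : Monotone φ') (s t : ℝ) : φ' s * (t - s) ≤ φ t - φ s := by
  have hc : Continuous φ := continuous_iff_continuousAt.2 fun t => (hφ t).continuousAt
  rcases lt_trichotomy s t with h | rfl | h
  · obtain ⟨c, hc1, hc2⟩ := exists_hasDerivAt_eq_slope φ φ' h hc.continuousOn fun t _ => hφ t
    rw [eq_div_iff (by linarith)] at hc2
    rw [← hc2]
    exact mul_le_mul_of_nonneg_right (hm hc1.1.le) (by linarith)
  · simp
  · obtain ⟨c, hc1, hc2⟩ := exists_hasDerivAt_eq_slope φ φ' h hc.continuousOn fun t _ => hφ t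
    rw [eq_div_iff (by linarith)] at hc2
    have := mul_le_mul_of_nonneg_right (hm hc1.2.le) (by linarith : 0 ≤ s - t)
    linarith

end Extension

/-! ### Part 2: realizing feasible data -/

theorem HasGradientAt.comp_sub_const_add {E : Type*} [NormedAddCommGroup E]
    [InnerProductSpace ℝ E] [CompleteSpace E] {f : E → ℝ} {γ x z : E} (a : ℝ)
    (hf : HasGradientAt f γ (z - x)) : HasGradientAt (fun z => a + f (z - x)) γ z := by
  rw [hasGradientAt_iff_hasFDerivAt] at *
  exact ((hasFDerivAt_comp_sub x).2 hf).const_add a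

/-- A gradient path along a line is realized by a differentiable function on the whole space that
is smooth and convex over the line segment. -/
theorem exists_smooth_convex_of_gradient_path {x h : EuclideanSpace ℝ (Fin d)} (hh : h ≠ 0)
    (a : ℝ) {G : ℝ → EuclideanSpace ℝ (Fin d)} (hc : Continuous G)
    (hl : ∀ s t, s ≤ t → ‖G s - G t‖ ≤ L * ‖h‖ * (t - s))
    (hm : Monotone fun t => inner ℝ (G t) h) (T : ℝ) :
    ∃ F : EuclideanSpace ℝ (Fin d) → ℝ, Differentiable ℝ F ∧
      SmoothOver L F (segment ℝ x (x + T • h)) ∧ ConvexOver F (segment ℝ x (x + T • h)) ∧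
      (∀ t : ℝ, F (x + t • h) = a + ∫ s in (0 : ℝ)..t, inner ℝ (G s) h) ∧
      ∀ t : ℝ, gradient F (x + t • h) = G t := by
  set Ψ : ℝ → EuclideanSpace ℝ (Fin d) := fun t => ∫ s in (0 : ℝ)..t, G s
  have hΨ : ∀ t, HasStrictDerivAt Ψ (G t) t := fun t => hc.integral_hasStrictDerivAt 0 t
  have hval : ∀ t : ℝ, inner ℝ (Ψ t) h = ∫ s in (0 : ℝ)..t, inner ℝ (G s) h := by
    intro t
    have := ((innerSL ℝ h).intervalIntegral_comp_comm (hc.intervalIntegrable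
      (μ := MeasureTheory.volume) 0 t)).symm
    simp only [innerSL_apply_apply] at this
    rw [real_inner_comm, this]
    exact intervalIntegral.integral_congr fun s _ => real_inner_comm _ _
  set F : EuclideanSpace ℝ (Fin d) → ℝ := fun z => a + lineExtension Ψ h (z - x)
  have hF : ∀ t : ℝ, F (x + t • h) = a + inner ℝ (Ψ t) h := fun t => by
    simp only [F, add_sub_cancel_left, lineExtension_smul hh]
  have hgrad : ∀ t : ℝ, gradient F (x + t • h) = G t := fun t => by
    refine (HasGradientAt.comp_sub_const_add a ?_).gradient
    rw [add_sub_cancel_left]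
    exact hasGradientAt_lineExtension hh (hΨ t)
  have hseg : ∀ u ∈ segment ℝ x (x + T • h), ∃ t : ℝ, u = x + t • h := by
    intro u hu
    rw [segment_eq_image'] at hu
    obtain ⟨θ, -, rfl⟩ := hu
    exact ⟨θ * T, by simp only [add_sub_cancel_left, smul_smul]⟩
  refine ⟨F, fun z => ?_, ?_, ?_, fun t => ?_, hgrad⟩
  · exact ((differentiable_lineExtension hh hΨ _).comp z
      (differentiableAt_id.sub_const x)).const_add a
  · intro u hu v hv
    obtain ⟨s, rfl⟩ := hseg u hu
    obtain ⟨t, rfl⟩ := hseg v hv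
    rw [hgrad, hgrad, add_sub_add_left_eq_sub, ← sub_smul, norm_smul, Real.norm_eq_abs]
    rcases le_total s t with hst | hst
    · rw [abs_sub_comm, abs_of_nonneg (by linarith)]
      linarith [hl s t hst]
    · rw [abs_of_nonneg (by linarith), norm_sub_rev]
      linarith [hl t s hst]
  · intro u hu v hv
    obtain ⟨s, rfl⟩ := hseg u hu
    obtain ⟨t, rfl⟩ := hseg v hv
    rw [hgrad, hF, hF, add_sub_add_left_eq_sub, add_sub_add_left_eq_sub, ← sub_smul,
      real_inner_smul_right]
    have := tangent_le_of_monotone_deriv (φ := fun t => inner ℝ (Ψ t) h)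
      (fun t => by simpa using (hΨ t).hasDerivAt.inner ℝ (hasDerivAt_const t h)) hm s t
    linarith
  · rw [hF, hval]

theorem hasGradientAt_affine {E : Type*} [NormedAddCommGroup E] [InnerProductSpace ℝ E]
    [CompleteSpace E] (a : ℝ) (γ x z : E) :
    HasGradientAt (fun z => a + inner ℝ γ (z - x)) γ z := by
  refine HasGradientAt.comp_sub_const_add a ?_
  rw [hasGradientAt_iff_hasFDerivAt]
  exact (InnerProductSpace.toDual ℝ E γ).hasFDerivAt

/-- Every feasible point of the program is realized by a function that is smooth and convex over
the segment. -/
theorem exists_smooth_convex_of_mem_feasibleValues {d : ℕ} {L : ℝ} (hL : 0 < L) {N : ℕ}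
    (hN : 0 < N) {x : EuclideanSpace ℝ (Fin d)} {fx : ℝ} {gx y : EuclideanSpace ℝ (Fin d)}
    {fy : ℝ} {gy : EuclideanSpace ℝ (Fin d)} (h : fy ∈ feasibleValues L N x fx gx y gy) :
    ∃ F : EuclideanSpace ℝ (Fin d) → ℝ,
      Differentiable ℝ F ∧ SmoothOver L F (segment ℝ x y) ∧ ConvexOver F (segment ℝ x y) ∧
      F x = fx ∧ F y = fy ∧ gradient F x = gx ∧ gradient F y = gy := by
  obtain ⟨f, g, hfg, rfl⟩ := h
  have hN' : (N : ℝ) ≠ 0 := by exact_mod_cast hN.ne'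
  -- With this direction, node `i` sits at parameter `i` and `y` at parameter `N`.
  set v := (1 / (N : ℝ)) • (y - x) with hv
  have hy : x + (N : ℝ) • v = y := by
    rw [hv, smul_smul, mul_one_div_cancel hN', one_smul, add_sub_cancel]
  obtain ⟨G, hc, hl, hm, h0, hend, hi⟩ := exists_gradient_path hL v
    -- The path lemma takes sequences on `ℕ`; the filler `0` beyond index `N` is never read.
    (fun i => if hi : i < N + 1 then f ⟨i, hi⟩ else 0)
    (fun i => if hi : i < N + 1 then g ⟨i, hi⟩ else 0) N
    (fun i hi => by
      have := hfg.backward ⟨i, hi⟩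
      have e : inner ℝ (g (Fin.succ ⟨i, hi⟩)) (x - y) =
        -inner ℝ (g (Fin.succ ⟨i, hi⟩)) (y - x) := by rw [← inner_neg_right, neg_sub]
      rw [e, mul_neg, sub_neg_eq_add, ← real_inner_smul_right] at this
      simp only [dif_pos (show i < N + 1 by omega), dif_pos (show i + 1 < N + 1 by omega)]
      exact this)
    (fun i hi => by
      have := hfg.forward ⟨i, hi⟩
      rw [← real_inner_smul_right] at this
      simp only [dif_pos (show i < N + 1 by omega), dif_pos (show i + 1 < N + 1 by omega)]
      exact this)
  have hgN : G N = gy := by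
    rw [hend N le_rfl, dif_pos (Nat.lt_succ_self N), ← hfg.grad_end]
    rfl
  have hg0 : G 0 = gx := by
    rw [h0, dif_pos (Nat.succ_pos N), ← hfg.grad_start]
    rfl
  have hint : fx + ∫ t in (0 : ℝ)..N, inner ℝ (G t) v = f (Fin.last N) := by
    rw [hi, dif_pos (Nat.lt_succ_self N), dif_pos (Nat.succ_pos N), ← hfg.value_start]
    exact add_sub_cancel _ _
  -- If `x = y` there is no line to extend from; the Lipschitz bound forces equal end gradients, and
  -- an affine function suffices.
  by_cases hv0 : v = 0
  · have hxy : y = x := by rw [← hy, hv0, smul_zero, add_zero]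
    have hgg : gy = gx := by
      have := hl 0 N (Nat.cast_nonneg N)
      rw [hv0, norm_zero, mul_zero, zero_mul, hg0, hgN] at this
      exact (sub_eq_zero.1 (norm_le_zero_iff.1 this)).symm
    have hgrad : ∀ z, gradient (fun z => fx + inner ℝ gx (z - x)) z = gx := fun z =>
      (hasGradientAt_affine fx gx x z).gradient
    have hff : f (Fin.last N) = fx := by simp [← hint, hv0]
    refine ⟨fun z => fx + inner ℝ gx (z - x), fun z => (hasGradientAt_affine fx gx x z).differentiableAt,
      fun u _ w _ => ?_, fun u _ w _ => ?_, by simp, by simp [hxy, hff], hgrad x, ?_⟩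
    · rw [hgrad, hgrad, sub_self, norm_zero]
      positivity
    · rw [hgrad]
      simp only [inner_sub_right]
      linarith
    · rw [hgrad, hgg]
  · obtain ⟨F, hF, hs, hcv, hval, hgrad⟩ :=
      exists_smooth_convex_of_gradient_path (L := L) (x := x) hv0 fx hc hl hm N
    rw [hy] at hs hcv
    refine ⟨F, hF, hs, hcv, ?_, ?_, ?_, ?_⟩
    · simpa using hval 0
    · rw [← hint, ← hval, hy]
    · simpa [hg0] using hgrad 0
    · rw [← hgN, ← hgrad, hy]

end SmoothConvex

theorem corollary6 (d : ℕ) (L : ℝ) (hL : 0 < L) :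
    -- the maximum and the minimum are attained whenever the programs are feasible
    (∀ (N : ℕ) (x : EuclideanSpace ℝ (Fin d)) (fx : ℝ) (gx y gy : EuclideanSpace ℝ (Fin d)),
      0 < N → (SmoothConvex.feasibleValues L N x fx gx y gy).Nonempty →
      (∃ b ∈ SmoothConvex.feasibleValues L N x fx gx y gy,
        SmoothConvex.lowerValue L N x fx gx y gy = (b : EReal)) ∧
      (∃ u ∈ SmoothConvex.feasibleValues L N x fx gx y gy,
        SmoothConvex.upperValue L N x fx gx y gy = (u : EReal))) ∧
    -- part 1
    (∀ (C : Set (EuclideanSpace ℝ (Fin d))) (f : EuclideanSpace ℝ (Fin d) → ℝ),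
      IsOpen C → Convex ℝ C → C ≠ Set.univ →
      DifferentiableOn ℝ f C → SmoothConvex.SmoothOver L f C → SmoothConvex.ConvexOver f C →
      ∀ x ∈ C, ∀ y ∈ C, ∀ N : ℕ,
        ‖y - x‖ / min (Metric.infDist x Cᶜ) (Metric.infDist y Cᶜ) < (N : ℝ) →
        SmoothConvex.lowerValue L N x (f x) (gradient f x) y (gradient f y) ≤ (f y : EReal) ∧
        (f y : EReal) ≤ SmoothConvex.upperValue L N x (f x) (gradient f x) y (gradient f y)) ∧
    -- part 2
    (∀ (N : ℕ) (x : EuclideanSpace ℝ (Fin d)) (fx : ℝ) (gx y : EuclideanSpace ℝ (Fin d))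
      (fy : ℝ) (gy : EuclideanSpace ℝ (Fin d)),
      0 < N →
      SmoothConvex.lowerValue L N x fx gx y gy ≤ (fy : EReal) →
      (fy : EReal) ≤ SmoothConvex.upperValue L N x fx gx y gy →
      ∃ F : EuclideanSpace ℝ (Fin d) → ℝ,
        Differentiable ℝ F ∧
        SmoothConvex.SmoothOver L F (segment ℝ x y) ∧
        SmoothConvex.ConvexOver F (segment ℝ x y) ∧
        F x = fx ∧ F y = fy ∧ gradient F x = gx ∧ gradient F y = gy) := by
  refine ⟨fun N x fx gx y gy _ h => ⟨SmoothConvex.exists_lowerValue_eq hL h,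
    SmoothConvex.exists_upperValue_eq hL h⟩, fun C f hC hconv hne hd hs hc x hx y hy N hN => ?_,
    fun N x fx gx y fy gy hN h1 h2 => SmoothConvex.exists_smooth_convex_of_mem_feasibleValues hL hN
      (SmoothConvex.mem_feasibleValues_of_between hL h1 h2)⟩
  have h := SmoothConvex.mem_feasibleValues_of_smooth_convex hL hC hconv hne hd hs hc hx hy hN
  exact ⟨iInf₂_le (f y) h, le_iSup₂ (f := fun (v : ℝ)
    (_ : v ∈ SmoothConvex.feasibleValues L N x (f x) (gradient f x) y (gradient f y)) =>
      (v : EReal)) (f y) h⟩
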